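/- Let $(M,g)$ be a smooth Riemannian or Lorentzian manifold (without boundary; Lorentzian signature $(-,+,\dots,+)$), and let $H_1,H_2\subset M$ be smooth embedded hypersurfaces. Let $I_\lambda,I_t\subset\mathbb R$ be open intervals with $0\in I_\lambda$ and $[0,\tau_0]\subset I_t$, where $\tau_0\ge 0$, and let $\Gamma:I_\lambda\times I_t\to M$ be a smooth one-parameter family of geodesics, i.e. $\Gamma$ is smooth and each $\gamma_\lambda:=\Gamma(\lambda,\cdot)$ is an affinely parametrized geodesic of $g$. Suppose that $x_0=\gamma_0(0)\in H_1$ and that $\gamma_0$ hits $H_2$ transversally at $y_0=\gamma_0(\tau_0)$. Put $x(\lambda)=\gamma_\lambda(0)$ and $h(\lambda)=g(\dot\gamma_\lambda(0),\dot\gamma_\lambda(0))$. Then there are $\varepsilon,\delta>0$ with $(-\varepsilon,\varepsilon)\subset I_\lambda$, $(\tau_0-\delta,\tau_0+\delta)\subset I_t$ such that for every $|\lambda|<\varepsilon$ there is exactly one $\tau_\lambda\in(\tau_0-\delta,\tau_0+\delta)$ with $\gamma_\lambda(\tau_\lambda)\in H_2$ (the travel time; at $\lambda=0$ it is the given $\tau_0$).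 The intersection of $\gamma_\lambda$ with $H_2$ at $\tau_\lambda$ is transversal, $\lambda\mapsto\tau_\lambda$ is smooth on $(-\varepsilon,\varepsilon)$, and $g(\dot\gamma_\lambda(t),\dot\gamma_\lambda(t))=h(\lambda)$ for all $t\in I_t$. With $y(\lambda)=\gamma_\lambda(\tau_\lambda)$, the functions $h,x,y$ are differentiable on $(-\varepsilon,\varepsilon)$ and $$2h(\lambda)\frac{d\tau_\lambda}{d\lambda}+h'(\lambda)\tau_\lambda=2g\big(y'(\lambda),\dot\gamma_\lambda(\tau_\lambda)\big)-2g\big(x'(\lambda),\dot\gamma_\lambda(0)\big)\qquad(|\lambda|<\varepsilon).$$ In particular, if $h(0)=0$ (that is, $\gamma_0$ is null) and $h'(0)\neq0$, then $$\tau_0=\frac{2}{h'(0)}\Big(g\big(y'(0),\dot\gamma_0(\tau_0)\big)-g\big(x'(0),\dot\gamma_0(0)\big)\Big).$$ -/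

import Mathlib

open scoped Manifold ContDiff Bundle

noncomputable section

/-- A smooth pseudo-Riemannian metric on a smooth manifold `M` modelled on `E`: a smooth section
of the bundle of bilinear forms on the tangent spaces which is symmetric and nondegenerate
at every point. -/
structure PseudoRiemannianMetric (E : Type*) [NormedAddCommGroup E] [NormedSpace ℝ E]
    (M : Type*) [TopologicalSpace M] [ChartedSpace E M] [IsManifold 𝓘(ℝ, E) ∞ M] where
  /-- the bilinear form on the tangent space at `x` -/
  val (x : M) : TangentSpace 𝓘(ℝ, E) x →L[ℝ] TangentSpace 𝓘(ℝ, E) x →L[ℝ] ℝ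
  symm (x : M) (v w : TangentSpace 𝓘(ℝ, E) x) : val x v w = val x w v
  nondegenerate (x : M) (v : TangentSpace 𝓘(ℝ, E) x) (hv : ∀ w, val x v w = 0) : v = 0
  contMDiff : ContMDiff 𝓘(ℝ, E) (𝓘(ℝ, E).prod 𝓘(ℝ, E →L[ℝ] E →L[ℝ] ℝ)) ∞
    (fun x ↦ Bundle.TotalSpace.mk' (E →L[ℝ] E →L[ℝ] ℝ)
      (E := fun x : M ↦ TangentSpace 𝓘(ℝ, E) x →L[ℝ] TangentSpace 𝓘(ℝ, E) x →L[ℝ] ℝ) x (val x))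

section Metric

variable {E : Type*} [NormedAddCommGroup E] [NormedSpace ℝ E]
  {M : Type*} [TopologicalSpace M] [ChartedSpace E M] [IsManifold 𝓘(ℝ, E) ∞ M]

/-- The metric is positive definite at every point. -/
def PseudoRiemannianMetric.IsRiemannian (g : PseudoRiemannianMetric E M) : Prop :=
  ∀ (x : M) (v : TangentSpace 𝓘(ℝ, E) x), v ≠ 0 → 0 < g.val x v v

/-- The metric has signature `(-, +, …, +)` at every point: there is a timelike vector on whose
orthogonal complement the metric is positive definite. -/
def PseudoRiemannianMetric.IsLorentzian (g : PseudoRiemannianMetric E M) : Prop :=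
  ∀ x : M, ∃ v : TangentSpace 𝓘(ℝ, E) x, g.val x v v < 0 ∧
    ∀ w : TangentSpace 𝓘(ℝ, E) x, g.val x v w = 0 → w ≠ 0 → 0 < g.val x w w

/-- The metric in the coordinates of the chart `e`, at the point `p` of the target of `e`:
the bilinear form `G_p(u, v) = g(dψ_p u, dψ_p v)` on `E`, where `ψ = e⁻¹`. -/
def PseudoRiemannianMetric.coord (g : PseudoRiemannianMetric E M) (e : OpenPartialHomeomorph M E)
    (p : E) : E →L[ℝ] E →L[ℝ] ℝ :=
  let B : E →L[ℝ] E →L[ℝ] ℝ := g.val (e.symm p)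
  let dψ : E →L[ℝ] E := mfderiv 𝓘(ℝ, E) 𝓘(ℝ, E) e.symm p
  B.bilinearComp dψ dψ

/-- `G_p(u, v) = g(dψ_p u, dψ_p v)`. -/
theorem PseudoRiemannianMetric.coord_apply (g : PseudoRiemannianMetric E M)
    (e : OpenPartialHomeomorph M E) (p u v : E) :
    g.coord e p u v = g.val (e.symm p) (mfderiv 𝓘(ℝ, E) 𝓘(ℝ, E) e.symm p u)
      (mfderiv 𝓘(ℝ, E) 𝓘(ℝ, E) e.symm p v) :=
  rfl

/-- The Christoffel symbols of the first kind of the Levi-Civita connection, in the chart `e`: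
the linear form `w ↦ ½ ((∂_u G)(v, w) + (∂_v G)(u, w) - (∂_w G)(u, v))`. -/
def PseudoRiemannianMetric.christoffelLower (g : PseudoRiemannianMetric E M)
    (e : OpenPartialHomeomorph M E) (p u v : E) : E →L[ℝ] ℝ :=
  (1 / 2 : ℝ) • (fderiv ℝ (g.coord e) p u v + fderiv ℝ (g.coord e) p v u
    - ((fderiv ℝ (g.coord e) p).flip u).flip v)

/-- The Christoffel symbols (of the second kind) of the Levi-Civita connection, in the chart `e`:
the vector `z = Γ_p(u, v)` with `G_p(z, w) = ½ ((∂_u G)(v, w) + (∂_v G)(u, w) - (∂_w G)(u, v))`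
for all `w`, see `PseudoRiemannianMetric.coord_christoffel`. -/
def PseudoRiemannianMetric.christoffel (g : PseudoRiemannianMetric E M)
    (e : OpenPartialHomeomorph M E) (p u v : E) : E :=
  ContinuousLinearMap.inverse (g.coord e p) (g.christoffelLower e p u v)

theorem PseudoRiemannianMetric.isInvertible_coord [FiniteDimensional ℝ E]
    (g : PseudoRiemannianMetric E M) {e : OpenPartialHomeomorph M E} (he : e ∈ atlas E M)
    {p : E} (hp : p ∈ e.target) : (g.coord e p).IsInvertible := by
  have he' : e.MDifferentiable 𝓘(ℝ, E) 𝓘(ℝ, E) := by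
    have := mdifferentiable_of_mem_atlas (I := 𝓘(ℝ, E)) he
    simpa using this
  have hinj : Function.Injective (mfderiv 𝓘(ℝ, E) 𝓘(ℝ, E) e.symm p) :=
    he'.symm.mfderiv_injective hp
  have hsurj : Function.Surjective (mfderiv 𝓘(ℝ, E) 𝓘(ℝ, E) e.symm p) :=
    he'.symm.mfderiv_surjective hp
  have hG : Function.Injective (g.coord e p) := by
    rw [injective_iff_map_eq_zero]
    intro u hu
    refine hinj ?_
    refine (g.nondegenerate (e.symm p) _ fun w ↦ ?_).trans
      (map_zero (mfderiv 𝓘(ℝ, E) 𝓘(ℝ, E) e.symm p)).symm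
    obtain ⟨u', rfl⟩ := hsurj w
    exact (g.coord_apply e p u u').symm.trans (by rw [hu]; rfl)
  have hfin : Module.finrank ℝ E = Module.finrank ℝ (E →L[ℝ] ℝ) := by
    rw [← Subspace.dual_finrank_eq]
    exact (LinearMap.toContinuousLinearMap (𝕜 := ℝ) (E := E) (F' := ℝ)).finrank_eq
  exact ⟨(LinearEquiv.ofInjectiveOfFinrankEq
    (g.coord e p).toLinearMap hG hfin).toContinuousLinearEquiv, rfl⟩

theorem PseudoRiemannianMetric.coord_christoffel [FiniteDimensional ℝ E]
    (g : PseudoRiemannianMetric E M) {e : OpenPartialHomeomorph M E} (he : e ∈ atlas E M)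
    {p : E} (hp : p ∈ e.target) (u v w : E) :
    g.coord e p (g.christoffel e p u v) w =
      1 / 2 * (fderiv ℝ (g.coord e) p u v w + fderiv ℝ (g.coord e) p v u w
        - fderiv ℝ (g.coord e) p w u v) := by
  obtain ⟨L, hL⟩ := g.isInvertible_coord he hp
  have : g.coord e p (g.christoffel e p u v) = g.christoffelLower e p u v := by
    rw [PseudoRiemannianMetric.christoffel, ← hL, ContinuousLinearMap.inverse_equiv]
    exact L.apply_symm_apply _
  rw [this]
  simp [PseudoRiemannianMetric.christoffelLower]

/-- The velocity `ċ(t) ∈ T_{c(t)} M` of a curve `c` in `M`. -/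
def velocity (c : ℝ → M) (t : ℝ) : TangentSpace 𝓘(ℝ, E) (c t) :=
  mfderiv 𝓘(ℝ, ℝ) 𝓘(ℝ, E) c t (1 : ℝ)

/-- `γ` is a geodesic of `g` (affinely parametrized) on the open set `s` of times: it is smooth
and satisfies the geodesic equation `c'' + Γ_c(c', c') = 0` in every chart. -/
structure PseudoRiemannianMetric.IsGeodesicOn (g : PseudoRiemannianMetric E M) (γ : ℝ → M)
    (s : Set ℝ) : Prop where
  contMDiffOn : ContMDiffOn 𝓘(ℝ, ℝ) 𝓘(ℝ, E) ∞ γ s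
  geodesic_eq : ∀ t ∈ s, ∀ e ∈ atlas E M, γ t ∈ e.source →
    deriv (deriv (e ∘ γ)) t +
      g.christoffel e (e (γ t)) (deriv (e ∘ γ) t) (deriv (e ∘ γ) t) = 0

end Metric

section Hypersurface

variable (E : Type*) [NormedAddCommGroup E] [NormedSpace ℝ E]
  {M : Type*} [TopologicalSpace M] [ChartedSpace E M]

/-- `φ` is a local defining function of `S` on the open set `U`: it is smooth on `U`, its zero
set in `U` is `S ∩ U`, and its differential does not vanish at any point of `S ∩ U`. -/
structure IsLocalDefiningFunction (S U : Set M) (φ : M → ℝ) : Prop where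
  isOpen : IsOpen U
  contMDiffOn : ContMDiffOn 𝓘(ℝ, E) 𝓘(ℝ, ℝ) ∞ φ U
  mem_iff : ∀ q ∈ U, q ∈ S ↔ φ q = 0
  mfderiv_ne_zero : ∀ q ∈ S ∩ U, mfderiv 𝓘(ℝ, E) 𝓘(ℝ, ℝ) φ q ≠ 0

/-- `S` is a smooth (embedded) hypersurface of `M`. -/
def IsSmoothHypersurface (S : Set M) : Prop :=
  ∀ p ∈ S, ∃ (U : Set M) (φ : M → ℝ), p ∈ U ∧ IsLocalDefiningFunction E S U φ

variable {E} in
/-- The tangent vector `v` at the point `p` of the hypersurface `S` is transversal to `S`, i.e.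
it does not lie in `T_p S = ker dφ_p`, where `φ` is a local defining function of `S` near `p`
(all of them have the same kernel at `p`). -/
def IsTransversalTo (S : Set M) {p : M} (v : TangentSpace 𝓘(ℝ, E) p) : Prop :=
  p ∈ S ∧ ∃ (U : Set M) (φ : M → ℝ), p ∈ U ∧ IsLocalDefiningFunction E S U φ ∧
    (mfderiv 𝓘(ℝ, E) 𝓘(ℝ, ℝ) φ p v : ℝ) ≠ 0

end Hypersurface

section Family

variable {E : Type*} [NormedAddCommGroup E] [NormedSpace ℝ E]
  {M : Type*} [TopologicalSpace M] [ChartedSpace E M] [IsManifold 𝓘(ℝ, E) ∞ M]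

/-- `Γ(l, t) = γ_l(t)` is a smooth one-parameter family of geodesics on `Il × It`, where `Il`
and `It` are open intervals. -/
structure PseudoRiemannianMetric.IsSmoothGeodesicFamily (g : PseudoRiemannianMetric E M)
    (Γ : ℝ → ℝ → M) (Il It : Set ℝ) : Prop where
  isOpen_param : IsOpen Il
  ordConnected_param : Il.OrdConnected
  isOpen_time : IsOpen It
  ordConnected_time : It.OrdConnected
  contMDiffOn : ContMDiffOn 𝓘(ℝ, ℝ × ℝ) 𝓘(ℝ, E) ∞ (fun z : ℝ × ℝ ↦ Γ z.1 z.2) (Il ×ˢ It)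
  isGeodesicOn : ∀ l ∈ Il, g.IsGeodesicOn (Γ l) It

/-- The quantity `h(l) = g(γ̇_l(0), γ̇_l(0))` of a family of curves. -/
def PseudoRiemannianMetric.energy (g : PseudoRiemannianMetric E M) (Γ : ℝ → ℝ → M) (l : ℝ) : ℝ :=
  g.val (Γ l 0) (velocity (E := E) (Γ l) 0) (velocity (E := E) (Γ l) 0)

end Family

end

/-! Two independent arguments. For the travel time, take a local defining function `φ` of `H₂` near
`y₀`: transversality says that the `t`-derivative of `φ ∘ Γ` is nonzero at `(0, τ₀)`, so the
implicit function theorem (`exists_contDiffOn_graph`) gives `τ`, and the derivative stays nonzero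
nearby.

For the formula, metric compatibility and vanishing torsion give `∂_t g(∂_tΓ, ∂_tΓ) = 0` and `2 ∂_t
g(∂_λΓ, ∂_tΓ) = ∂_λ g(∂_tΓ, ∂_tΓ) = h'(λ)`. Hence `2 g(∂_λΓ, ∂_tΓ)` is affine in `t` with slope
`h'(λ)` (`pullback_param_time`). Evaluating it at `0` and `τ_λ`, where `x' = ∂_λΓ` and `y' = ∂_λΓ +
τ' ∂_tΓ`, yields `first_variation`. The two identities are checked in a chart in
`PseudoRiemannianMetric.fderiv_pullback`, with Christoffel symbols in place of covariant
derivatives. -/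

/-! ### Implicit function theorem for the travel time -/

/-- The solution set of a scalar equation `F (l, t) = 0` near a point where `∂F/∂t ≠ 0` is the
graph of a smooth function. -/
theorem exists_contDiffOn_graph {F : ℝ × ℝ → ℝ} {W : Set (ℝ × ℝ)} (hW : IsOpen W)
    (hF : ContDiffOn ℝ ∞ F W) {t₀ : ℝ} (h0 : ((0 : ℝ), t₀) ∈ W) (hF0 : F (0, t₀) = 0)
    (hF' : fderiv ℝ F (0, t₀) (0, 1) ≠ 0) :
    ∃ ε > 0, ∃ δ > 0, ∃ τ : ℝ → ℝ,
      Set.Ioo (-ε) ε ×ˢ Set.Ioo (t₀ - δ) (t₀ + δ) ⊆ W ∧ τ 0 = t₀ ∧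
      (∀ l ∈ Set.Ioo (-ε) ε, τ l ∈ Set.Ioo (t₀ - δ) (t₀ + δ) ∧
        fderiv ℝ F (l, τ l) (0, 1) ≠ 0 ∧
        ∀ t ∈ Set.Ioo (t₀ - δ) (t₀ + δ), F (l, t) = 0 ↔ t = τ l) ∧
      ContDiffOn ℝ ∞ τ (Set.Ioo (-ε) ε) := by
  have hFat : ∀ z ∈ W, ContDiffAt ℝ ∞ F z := fun z hz ↦ hF.contDiffAt (hW.mem_nhds hz)
  -- `Φ` straightens the zero set of `F` to the first axis; `τ l` will be the second component of
  -- `Φ⁻¹(l, 0)`.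
  set Φ : ℝ × ℝ → ℝ × ℝ := fun z ↦ (z.1, F z) with hΦ
  have hΦat : ∀ z ∈ W, ContDiffAt ℝ ∞ Φ z := fun z hz ↦ contDiffAt_fst.prodMk (hFat z hz)
  have hequiv : ∀ z ∈ W, fderiv ℝ F z (0, 1) ≠ 0 →
      ∃ L : (ℝ × ℝ) ≃L[ℝ] ℝ × ℝ, HasFDerivAt Φ (L : ℝ × ℝ →L[ℝ] ℝ × ℝ) z := by
    intro z hz hne
    have hd : HasFDerivAt Φ ((ContinuousLinearMap.fst ℝ ℝ ℝ).prod (fderiv ℝ F z)) z :=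
      hasFDerivAt_fst.prodMk ((hFat z hz).differentiableAt (by simp)).hasFDerivAt
    have hinj : Function.Injective
        ((ContinuousLinearMap.fst ℝ ℝ ℝ).prod (fderiv ℝ F z)).toLinearMap := by
      rw [injective_iff_map_eq_zero]
      rintro ⟨a, b⟩ hab
      have h1 : a = 0 := congrArg Prod.fst hab
      have h2 : fderiv ℝ F z (a, b) = 0 := congrArg Prod.snd hab
      subst h1
      have h3 : ((0 : ℝ), b) = b • ((0 : ℝ), (1 : ℝ)) := by simp
      rw [h3, map_smul, smul_eq_mul] at h2
      rw [(mul_eq_zero.1 h2).resolve_right hne]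
      rfl
    exact ⟨(LinearEquiv.ofInjectiveEndo _ hinj).toContinuousLinearEquiv, hd⟩
  obtain ⟨L₀, hL₀⟩ := hequiv _ h0 hF'
  set P := (hΦat _ h0).toOpenPartialHomeomorph Φ hL₀ (by simp) with hP
  have hPc : ∀ z, P z = Φ z := fun z ↦ rfl
  have hPs : ((0 : ℝ), t₀) ∈ P.source :=
    (hΦat _ h0).mem_toOpenPartialHomeomorph_source hL₀ (by simp)
  have hP0 : P (0, t₀) = (0, 0) := by rw [hPc]; simp [hΦ, hF0]
  have hPt : ((0 : ℝ), (0 : ℝ)) ∈ P.target := hP0 ▸ P.map_source hPs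
  have hPsymm : P.symm (0, 0) = (0, t₀) := by rw [← hP0, P.left_inv hPs]
  have hcont : ContinuousAt (fun z ↦ fderiv ℝ F z (0, 1)) (0, t₀) :=
    ((hFat _ h0).continuousAt_fderiv (by simp)).clm_apply continuousAt_const
  -- Nonvanishing on a whole box is kept, since both smoothness of `τ` and transversality are
  -- claimed at every `l`, not only at `0`.
  have hN : ∀ᶠ z in nhds ((0 : ℝ), t₀), z ∈ W ∧ z ∈ P.source ∧ fderiv ℝ F z (0, 1) ≠ 0 :=
    (hW.eventually_mem h0).and
      ((P.open_source.eventually_mem hPs).and (hcont.eventually_ne hF'))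
  obtain ⟨δ, hδ, hball⟩ := Metric.eventually_nhds_iff.1 hN
  have hbox : ∀ l t, l ∈ Set.Ioo (-δ) δ → t ∈ Set.Ioo (t₀ - δ) (t₀ + δ) →
      (l, t) ∈ W ∧ (l, t) ∈ P.source ∧ fderiv ℝ F (l, t) (0, 1) ≠ 0 := by
    intro l t hl ht
    refine hball ?_
    rw [Prod.dist_eq, max_lt_iff, Real.dist_eq, Real.dist_eq, abs_lt, abs_lt]
    exact ⟨⟨by linarith [hl.1], by linarith [hl.2]⟩, ⟨by linarith [ht.1], by linarith [ht.2]⟩⟩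
  have hι : Continuous fun l : ℝ ↦ (l, (0 : ℝ)) := by fun_prop
  have hcs : ContinuousAt (fun l : ℝ ↦ (P.symm (l, 0)).2) 0 :=
    ContinuousAt.snd (ContinuousAt.comp (f := fun l : ℝ ↦ (l, (0 : ℝ))) (g := P.symm)
      (P.continuousAt_symm hPt) hι.continuousAt)
  have hev : ∀ᶠ l in nhds (0 : ℝ), (l, (0 : ℝ)) ∈ P.target ∧
      (P.symm (l, 0)).2 ∈ Set.Ioo (t₀ - δ) (t₀ + δ) := by
    refine (hι.continuousAt.eventually (P.open_target.eventually_mem hPt)).and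
      (hcs.eventually (isOpen_Ioo.eventually_mem ?_))
    simp only [hPsymm]
    exact ⟨by linarith, by linarith⟩
  obtain ⟨ε₀, hε₀, hball'⟩ := Metric.eventually_nhds_iff.1 hev
  have hsub : ∀ l ∈ Set.Ioo (-(min ε₀ δ)) (min ε₀ δ), l ∈ Set.Ioo (-δ) δ ∧
      (l, (0 : ℝ)) ∈ P.target ∧ (P.symm (l, 0)).2 ∈ Set.Ioo (t₀ - δ) (t₀ + δ) := by
    intro l hl
    have h1 := abs_lt.2 hl
    have h2 := abs_lt.1 (lt_of_lt_of_le h1 (min_le_right _ _))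
    exact ⟨h2, hball' (by
      rw [Real.dist_eq, sub_zero]; exact lt_of_lt_of_le h1 (min_le_left _ _))⟩
  have hinv : ∀ l, (l, (0 : ℝ)) ∈ P.target →
      P.symm (l, 0) = (l, (P.symm (l, 0)).2) ∧ F (l, (P.symm (l, 0)).2) = 0 := by
    intro l hl
    have h1 : Φ (P.symm (l, 0)) = (l, 0) := P.right_inv hl
    have h2 : (P.symm (l, 0)).1 = l := congrArg Prod.fst h1
    have h3 : P.symm (l, 0) = (l, (P.symm (l, 0)).2) := Prod.ext h2 rfl
    exact ⟨h3, h3 ▸ congrArg Prod.snd h1⟩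
  refine ⟨min ε₀ δ, lt_min hε₀ hδ, δ, hδ, fun l ↦ (P.symm (l, 0)).2, ?_, ?_, ?_, ?_⟩
  · rintro ⟨l, t⟩ ⟨hl, ht⟩
    exact (hbox l t (hsub l hl).1 ht).1
  · simp [hPsymm]
  · intro l hl
    obtain ⟨h1, h2, h3⟩ := hsub l hl
    refine ⟨h3, (hbox _ _ h1 h3).2.2, fun t ht ↦ ⟨fun h ↦ ?_, ?_⟩⟩
    · have : P (l, t) = (l, 0) := by rw [hPc]; simp [hΦ, h]
      simp only [← this, P.left_inv (hbox _ _ h1 ht).2.1]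
    · rintro rfl
      exact (hinv l h2).2
  · intro l hl
    obtain ⟨h1, h2, h3⟩ := hsub l hl
    have hb := hbox _ _ h1 h3
    -- Smoothness of the inverse away from `(0, 0)` needs the derivative of `Φ` to be invertible at
    -- the preimage of `(l, 0)` itself.
    obtain ⟨L, hL⟩ := hequiv _ hb.1 hb.2.2
    have hs : ContDiffAt ℝ ∞ P.symm (l, 0) :=
      P.contDiffAt_symm h2 (f₀' := L) (by rw [(hinv l h2).1]; exact hL)
        (by rw [(hinv l h2).1]; exact hΦat _ hb.1)
    have hc : ContDiffAt ℝ ∞ (fun l : ℝ ↦ P.symm (l, 0)) l :=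
      hs.comp (f := fun l : ℝ ↦ (l, (0 : ℝ))) l (by fun_prop)
    exact hc.snd.contDiffWithinAt

/-! ### The metric in a chart -/

set_option synthInstance.maxHeartbeats 200000 in
/-- Product rule for `z ↦ G_{C z}(dC_z a, dC_z b)`. -/
theorem fderiv_bilin_apply_fderiv {X E : Type*} [NormedAddCommGroup X] [NormedSpace ℝ X]
    [NormedAddCommGroup E] [NormedSpace ℝ E] {G : E → E →L[ℝ] E →L[ℝ] ℝ} {C : X → E} {z : X}
    (hG : DifferentiableAt ℝ G (C z)) (hC : ContDiffAt ℝ 2 C z) (a b : X) :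
    DifferentiableAt ℝ (fun x ↦ G (C x) (fderiv ℝ C x a) (fderiv ℝ C x b)) z ∧ ∀ w,
    fderiv ℝ (fun x ↦ G (C x) (fderiv ℝ C x a) (fderiv ℝ C x b)) z w =
      fderiv ℝ G (C z) (fderiv ℝ C z w) (fderiv ℝ C z a) (fderiv ℝ C z b) +
      G (C z) (fderiv ℝ (fderiv ℝ C) z w a) (fderiv ℝ C z b) +
      G (C z) (fderiv ℝ C z a) (fderiv ℝ (fderiv ℝ C) z w b) := by
  have hC1 : HasFDerivAt C (fderiv ℝ C z) z := (hC.differentiableAt (by simp)).hasFDerivAt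
  have hC2 : HasFDerivAt (fderiv ℝ C) (fderiv ℝ (fderiv ℝ C) z) z :=
    ((hC.fderiv_right (m := 1) (by norm_num)).differentiableAt (by simp)).hasFDerivAt
  have hGC : HasFDerivAt (fun x ↦ G (C x)) ((fderiv ℝ G (C z)).comp (fderiv ℝ C z)) z :=
    HasFDerivAt.comp (G := E →L[ℝ] E →L[ℝ] ℝ) z hG.hasFDerivAt hC1
  have h := (hGC.clm_apply (hC2.clm_apply (hasFDerivAt_const a z))).clm_apply
    (hC2.clm_apply (hasFDerivAt_const b z))
  refine ⟨h.differentiableAt, fun w ↦ ?_⟩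
  rw [h.fderiv]
  simp
  ring

section Coord

variable {E : Type*} [NormedAddCommGroup E] [NormedSpace ℝ E] [FiniteDimensional ℝ E]
  {M : Type*} [TopologicalSpace M] [ChartedSpace E M] [IsManifold 𝓘(ℝ, E) ∞ M]

theorem PseudoRiemannianMetric.contDiffOn_coord (g : PseudoRiemannianMetric E M)
    {e : OpenPartialHomeomorph M E} (he : e ∈ IsManifold.maximalAtlas 𝓘(ℝ, E) ∞ M) :
    ContDiffOn ℝ ∞ (g.coord e) e.target := by
  have hs := contMDiffOn_symm_of_mem_maximalAtlas he
  -- The coordinate vector field of direction `u` is the tangent map of `e.symm` applied to a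
  -- constant section.
  have hfield : ∀ u : E, ContMDiffOn 𝓘(ℝ, E) (𝓘(ℝ, E).prod 𝓘(ℝ, E)) ∞
      (fun p ↦ Bundle.TotalSpace.mk' E (E := fun x : M ↦ TangentSpace 𝓘(ℝ, E) x) (e.symm p)
        (mfderiv 𝓘(ℝ, E) 𝓘(ℝ, E) e.symm p u)) e.target := by
    intro u
    have h1 := hs.contMDiffOn_tangentMapWithin (m := ∞) (by simp)
      e.open_target.uniqueMDiffOn
    have h2 : ContMDiff 𝓘(ℝ, E) (𝓘(ℝ, E).prod 𝓘(ℝ, E)) ∞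
        (fun p : E ↦ (⟨p, u⟩ : TangentBundle 𝓘(ℝ, E) E)) := by
      rw [contMDiff_vectorSpace_iff_contDiff (V := fun p : E ↦ (u : TangentSpace 𝓘(ℝ, E) p))]
      exact contDiff_const
    refine (h1.comp h2.contMDiffOn fun p hp ↦ hp).congr fun p hp ↦ ?_
    simp only [Function.comp_apply, tangentMapWithin]
    rw [mfderivWithin_of_isOpen e.open_target hp]
  -- In finite dimension, smoothness of an operator-valued map can be tested on fixed vectors.
  rw [contDiffOn_clm_apply]
  intro u
  rw [contDiffOn_clm_apply]
  intro v
  rw [← contMDiffOn_iff_contDiffOn]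
  have hg := (g.contMDiff.comp_contMDiffOn hs)
  have := ContMDiffOn.clm_bundle_apply₂ (F₁ := E) (F₂ := E) (F₃ := ℝ) (b := e.symm)
    (E₁ := fun x : M ↦ TangentSpace 𝓘(ℝ, E) x) (E₂ := fun x : M ↦ TangentSpace 𝓘(ℝ, E) x)
    (E₃ := Bundle.Trivial M ℝ) hg (hfield u) (hfield v)
  intro p hp
  have := this p hp
  rw [Bundle.contMDiffWithinAt_totalSpace] at this
  exact this.2

end Coord

/-! ### Pulled-back metric and the geodesic identities -/

section Pullback

variable {E : Type*} [NormedAddCommGroup E] [NormedSpace ℝ E]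
  {M : Type*} [TopologicalSpace M] [ChartedSpace E M]

/-- Chain rule for the velocity of `F ∘ c`. -/
theorem velocity_comp {X : Type*} [NormedAddCommGroup X] [NormedSpace ℝ X] {F : X → M}
    {c : ℝ → X} {c' : X} {s : ℝ} (hF : MDifferentiableAt 𝓘(ℝ, X) 𝓘(ℝ, E) F (c s))
    (hc : HasDerivAt c c' s) :
    velocity (E := E) (fun s ↦ F (c s)) s = mfderiv 𝓘(ℝ, X) 𝓘(ℝ, E) F (c s) c' := by
  have h := mfderiv_comp s hF hc.differentiableAt.mdifferentiableAt
  have h' := congrArg (fun A : ℝ →L[ℝ] E ↦ A 1) h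
  refine h'.trans ?_
  have h1 : (mfderiv 𝓘(ℝ, ℝ) 𝓘(ℝ, X) c s : ℝ →L[ℝ] X) 1 = c' := by
    rw [mfderiv_eq_fderiv, hc.hasFDerivAt.fderiv]
    exact one_smul ℝ c'
  exact congrArg (mfderiv 𝓘(ℝ, X) 𝓘(ℝ, E) F (c s)) h1

variable [IsManifold 𝓘(ℝ, E) ∞ M]

/-- The function `z ↦ g(dF_z a, dF_z b)`. -/
noncomputable def PseudoRiemannianMetric.pullback (g : PseudoRiemannianMetric E M) {X : Type*}
    [NormedAddCommGroup X] [NormedSpace ℝ X] (F : X → M) (a b z : X) : ℝ :=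
  g.val (F z) (mfderiv 𝓘(ℝ, X) 𝓘(ℝ, E) F z a) (mfderiv 𝓘(ℝ, X) 𝓘(ℝ, E) F z b)

theorem PseudoRiemannianMetric.pullback_eq_coord (g : PseudoRiemannianMetric E M) {X : Type*}
    [NormedAddCommGroup X] [NormedSpace ℝ X] {F : X → M} {z : X}
    (hF : MDifferentiableAt 𝓘(ℝ, X) 𝓘(ℝ, E) F z)
    {e : OpenPartialHomeomorph M E} (he : e ∈ atlas E M) (hz : F z ∈ e.source) (a b : X) :
    g.pullback F a b z =
      g.coord e (e (F z)) (fderiv ℝ (e ∘ F) z a) (fderiv ℝ (e ∘ F) z b) := by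
  have he' : e.MDifferentiable 𝓘(ℝ, E) 𝓘(ℝ, E) := by
    have := mdifferentiable_of_mem_atlas (I := 𝓘(ℝ, E)) he
    simpa using this
  have hd : ∀ a : X, (mfderiv 𝓘(ℝ, E) 𝓘(ℝ, E) e.symm (e (F z)) (fderiv ℝ (e ∘ F) z a) : E) =
      mfderiv 𝓘(ℝ, X) 𝓘(ℝ, E) F z a := by
    intro a
    rw [← mfderiv_eq_fderiv, mfderiv_comp z (he'.mdifferentiableAt hz) hF]
    exact congrArg (fun A : E →L[ℝ] E ↦ A (mfderiv 𝓘(ℝ, X) 𝓘(ℝ, E) F z a))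
      (he'.symm_comp_deriv hz)
  -- `e.symm (e (F z))` equals `F z` only propositionally, so the base point is generalized with the
  -- vectors viewed in `E`.
  have hval : ∀ (x : M) (_ : x = F z) (v w : E),
      (g.val x : E →L[ℝ] E →L[ℝ] ℝ) v w = (g.val (F z) : E →L[ℝ] E →L[ℝ] ℝ) v w := by
    rintro x rfl v w
    rfl
  rw [g.coord_apply]
  refine Eq.trans ?_ (hval _ (e.left_inv hz) _ _).symm
  rw [hd, hd]
  rfl

theorem PseudoRiemannianMetric.coord_symm (g : PseudoRiemannianMetric E M)
    (e : OpenPartialHomeomorph M E) (p u v : E) : g.coord e p u v = g.coord e p v u := by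
  rw [g.coord_apply, g.coord_apply]
  exact g.symm (e.symm p) _ _

set_option synthInstance.maxHeartbeats 200000 in
theorem PseudoRiemannianMetric.fderiv_coord_symm (g : PseudoRiemannianMetric E M)
    {e : OpenPartialHomeomorph M E} {p : E} (hG : DifferentiableAt ℝ (g.coord e) p) (w u v : E) :
    fderiv ℝ (g.coord e) p w u v = fderiv ℝ (g.coord e) p w v u := by
  have h : ∀ u v, HasFDerivAt (fun q ↦ g.coord e q u v)
      (((fderiv ℝ (g.coord e) p).flip u).flip v) p := by
    intro u v
    have := (hG.hasFDerivAt.clm_apply (hasFDerivAt_const u p)).clm_apply (hasFDerivAt_const v p)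
    refine this.congr_fderiv ?_
    ext
    simp
  have h1 := h v u
  simp only [g.coord_symm e _ v u] at h1
  exact congrArg (fun A : E →L[ℝ] ℝ ↦ A w) ((h u v).unique h1)

variable [FiniteDimensional ℝ E]

/-- The first order identities behind the conservation of energy and the first variation formula
for a map satisfying the geodesic equation in the direction `b`. -/
theorem PseudoRiemannianMetric.fderiv_pullback (g : PseudoRiemannianMetric E M) {X : Type*}
    [NormedAddCommGroup X] [NormedSpace ℝ X] {F : X → M} {z : X}
    (hF : ContMDiffAt 𝓘(ℝ, X) 𝓘(ℝ, E) ∞ F z) {e : OpenPartialHomeomorph M E}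
    (he : e ∈ atlas E M) (hz : F z ∈ e.source) (a b : X)
    (hgeo : fderiv ℝ (fderiv ℝ (e ∘ F)) z b b +
      g.christoffel e (e (F z)) (fderiv ℝ (e ∘ F) z b) (fderiv ℝ (e ∘ F) z b) = 0) :
    (∀ v w, DifferentiableAt ℝ (g.pullback F v w) z) ∧ fderiv ℝ (g.pullback F b b) z b = 0 ∧
      2 * fderiv ℝ (g.pullback F a b) z b = fderiv ℝ (g.pullback F b b) z a := by
  have hem : e ∈ IsManifold.maximalAtlas 𝓘(ℝ, E) ∞ M := IsManifold.subset_maximalAtlas he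
  have hC : ContDiffAt ℝ ∞ (e ∘ F) z :=
    ((contMDiffAt_of_mem_maximalAtlas hem hz).comp z hF).contDiffAt
  have hp : e (F z) ∈ e.target := e.map_source hz
  have hG : DifferentiableAt ℝ (g.coord e) (e (F z)) :=
    ((g.contDiffOn_coord hem).contDiffAt (e.open_target.mem_nhds hp)).differentiableAt (by simp)
  have hev : ∀ v w, g.pullback F v w =ᶠ[nhds z] fun x ↦ g.coord e ((e ∘ F) x)
      (fderiv ℝ (e ∘ F) x v) (fderiv ℝ (e ∘ F) x w) := by
    intro v w
    have h1 : ∀ᶠ x in nhds z, ContMDiffAt 𝓘(ℝ, X) 𝓘(ℝ, E) 1 F x :=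
      (contMDiffAt_iff_contMDiffAt_nhds (by simp)).1 (hF.of_le (by norm_cast))
    filter_upwards [h1, hF.continuousAt.eventually (e.open_source.eventually_mem hz)] with x hx hx'
    exact g.pullback_eq_coord (hx.mdifferentiableAt (by simp)) he hx' v w
  have hprod := fun v w ↦ fderiv_bilin_apply_fderiv (G := g.coord e) (C := e ∘ F) hG
    (hC.of_le (m := 2) (by norm_cast)) v w
  -- Lowering the index of the geodesic equation removes the inverse metric hidden in `christoffel`.
  have hacc : ∀ w, g.coord e (e (F z)) (fderiv ℝ (fderiv ℝ (e ∘ F)) z b b) w =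
      -(1 / 2 * (fderiv ℝ (g.coord e) (e (F z)) (fderiv ℝ (e ∘ F) z b) (fderiv ℝ (e ∘ F) z b) w +
        fderiv ℝ (g.coord e) (e (F z)) (fderiv ℝ (e ∘ F) z b) (fderiv ℝ (e ∘ F) z b) w -
        fderiv ℝ (g.coord e) (e (F z)) w (fderiv ℝ (e ∘ F) z b) (fderiv ℝ (e ∘ F) z b))) := by
    intro w
    rw [eq_neg_of_add_eq_zero_left hgeo, map_neg, _root_.neg_apply,
      g.coord_christoffel he hp]
  -- Symmetry of second derivatives plays the role of vanishing torsion.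
  have hsymm : fderiv ℝ (fderiv ℝ (e ∘ F)) z b a = fderiv ℝ (fderiv ℝ (e ∘ F)) z a b :=
    (hC.isSymmSndFDerivAt (by simp; norm_cast)) b a
  refine ⟨fun v w ↦ ((hev v w).differentiableAt_iff).2 (hprod v w).1, ?_, ?_⟩
  -- With `v = dC b`, the two acceleration terms contribute `-(∂_v G)(v, v)`, cancelling the
  -- derivative of `G`.
  · rw [(hev b b).fderiv_eq, (hprod b b).2, Function.comp_apply,
      g.coord_symm e _ (fderiv ℝ (e ∘ F) z b), hacc]
    ring
  -- With `w = dC a`, the acceleration term cancels `(∂_v G)(w, v)` and leaves `½ (∂_w G)(v, v)`;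
  -- the mixed second derivatives agree by `hsymm`.
  · rw [(hev a b).fderiv_eq, (hprod a b).2, (hev b b).fderiv_eq, (hprod b b).2, hsymm,
      Function.comp_apply, g.coord_symm e _ (fderiv ℝ (e ∘ F) z a), hacc,
      g.coord_symm e _ (fderiv ℝ (e ∘ F) z b) (fderiv ℝ (fderiv ℝ (e ∘ F)) z a b),
      g.fderiv_coord_symm hG _ (fderiv ℝ (e ∘ F) z a)]
    ring

end Pullback

/-! ### Energy and first variation of a geodesic family -/

section Family

variable {E : Type*} [NormedAddCommGroup E] [NormedSpace ℝ E]
  {M : Type*} [TopologicalSpace M] [ChartedSpace E M] [IsManifold 𝓘(ℝ, E) ∞ M]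
  {g : PseudoRiemannianMetric E M} {Γ : ℝ → ℝ → M} {Il It : Set ℝ}

namespace PseudoRiemannianMetric.IsSmoothGeodesicFamily

theorem contMDiffAt (hΓ : g.IsSmoothGeodesicFamily Γ Il It) {z : ℝ × ℝ} (hz : z ∈ Il ×ˢ It) :
    ContMDiffAt 𝓘(ℝ, ℝ × ℝ) 𝓘(ℝ, E) ∞ (fun z : ℝ × ℝ ↦ Γ z.1 z.2) z :=
  hΓ.contMDiffOn.contMDiffAt ((hΓ.isOpen_param.prod hΓ.isOpen_time).mem_nhds hz)

theorem mdifferentiableAt (hΓ : g.IsSmoothGeodesicFamily Γ Il It) {z : ℝ × ℝ} (hz : z ∈ Il ×ˢ It) :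
    MDifferentiableAt 𝓘(ℝ, ℝ × ℝ) 𝓘(ℝ, E) (fun z : ℝ × ℝ ↦ Γ z.1 z.2) z :=
  (hΓ.contMDiffAt hz).mdifferentiableAt (by simp)

theorem velocity_time (hΓ : g.IsSmoothGeodesicFamily Γ Il It) {l t : ℝ} (hz : (l, t) ∈ Il ×ˢ It) :
    velocity (E := E) (Γ l) t =
      mfderiv 𝓘(ℝ, ℝ × ℝ) 𝓘(ℝ, E) (fun z : ℝ × ℝ ↦ Γ z.1 z.2) (l, t) ((0, 1) : ℝ × ℝ) := by
  have hc : HasDerivAt (fun s : ℝ ↦ (l, s)) ((0, 1) : ℝ × ℝ) t :=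
    (hasDerivAt_const t l).prodMk (hasDerivAt_id t)
  exact velocity_comp (c := fun s : ℝ ↦ (l, s)) (hΓ.mdifferentiableAt hz) hc

theorem velocity_graph (hΓ : g.IsSmoothGeodesicFamily Γ Il It)
    {τ : ℝ → ℝ} {l : ℝ} (hτ : DifferentiableAt ℝ τ l)
    (hz : (l, τ l) ∈ Il ×ˢ It) :
    velocity (E := E) (fun s ↦ Γ s (τ s)) l =
      mfderiv 𝓘(ℝ, ℝ × ℝ) 𝓘(ℝ, E) (fun z : ℝ × ℝ ↦ Γ z.1 z.2) (l, τ l)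
        ((1, deriv τ l) : ℝ × ℝ) := by
  have hc : HasDerivAt (fun s : ℝ ↦ (s, τ s)) ((1, deriv τ l) : ℝ × ℝ) l :=
    (hasDerivAt_id l).prodMk hτ.hasDerivAt
  exact velocity_comp (c := fun s : ℝ ↦ (s, τ s)) (hΓ.mdifferentiableAt hz) hc

theorem mdifferentiableAt_graph (hΓ : g.IsSmoothGeodesicFamily Γ Il It)
    {τ : ℝ → ℝ} {l : ℝ} (hτ : DifferentiableAt ℝ τ l)
    (hz : (l, τ l) ∈ Il ×ˢ It) :
    MDifferentiableAt 𝓘(ℝ, ℝ) 𝓘(ℝ, E) (fun s ↦ Γ s (τ s)) l :=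
  MDifferentiableAt.comp (g := fun z : ℝ × ℝ ↦ Γ z.1 z.2) (f := fun s : ℝ ↦ (s, τ s)) l
    (hΓ.mdifferentiableAt hz) (differentiableAt_id.prodMk hτ).mdifferentiableAt

/-- Turns the one-variable geodesic equation of each `γ_l` into the two-variable form that
`PseudoRiemannianMetric.fderiv_pullback` takes as hypothesis. -/
theorem geodesic_eq_fderiv (hΓ : g.IsSmoothGeodesicFamily Γ Il It)
    {z : ℝ × ℝ} (hz : z ∈ Il ×ˢ It)
    {e : OpenPartialHomeomorph M E} (he : e ∈ atlas E M) (hze : Γ z.1 z.2 ∈ e.source) :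
    fderiv ℝ (fderiv ℝ (e ∘ fun z : ℝ × ℝ ↦ Γ z.1 z.2)) z (0, 1) (0, 1) +
      g.christoffel e (e (Γ z.1 z.2))
        (fderiv ℝ (e ∘ fun z : ℝ × ℝ ↦ Γ z.1 z.2) z (0, 1))
        (fderiv ℝ (e ∘ fun z : ℝ × ℝ ↦ Γ z.1 z.2) z (0, 1)) = 0 := by
  obtain ⟨l, t⟩ := z
  set C := e ∘ fun z : ℝ × ℝ ↦ Γ z.1 z.2 with hCdef
  have hem : e ∈ IsManifold.maximalAtlas 𝓘(ℝ, E) ∞ M := IsManifold.subset_maximalAtlas he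
  have hC : ContDiffAt ℝ ∞ C (l, t) :=
    ((contMDiffAt_of_mem_maximalAtlas hem hze).comp (l, t) (hΓ.contMDiffAt hz)).contDiffAt
  have hι : ∀ s : ℝ, HasDerivAt (fun s : ℝ ↦ (l, s)) ((0, 1) : ℝ × ℝ) s := fun s ↦
    (hasDerivAt_const s l).prodMk (hasDerivAt_id s)
  have h1 : ∀ᶠ z in nhds (l, t), ContDiffAt ℝ 1 C z :=
    (hC.of_le (m := 1) (by norm_cast)).eventually (by simp)
  have h2 : deriv (e ∘ Γ l) =ᶠ[nhds t] fun s ↦ fderiv ℝ C (l, s) (0, 1) := by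
    filter_upwards [(hι t).continuousAt.eventually h1] with s hs
    exact ((hs.differentiableAt (by simp)).hasFDerivAt.comp_hasDerivAt s (hι s)).deriv
  have h3 : HasFDerivAt (fderiv ℝ C) (fderiv ℝ (fderiv ℝ C) (l, t)) (l, t) :=
    ((hC.fderiv_right (m := 1) (by norm_cast)).differentiableAt (by simp)).hasFDerivAt
  have h4 : HasDerivAt (fun s ↦ fderiv ℝ C (l, s) (0, 1))
      (fderiv ℝ (fderiv ℝ C) (l, t) (0, 1) (0, 1)) t := by
    simpa using (h3.comp_hasDerivAt t (hι t)).clm_apply (hasDerivAt_const t ((0, 1) : ℝ × ℝ))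
  have h := (hΓ.isGeodesicOn l hz.1).geodesic_eq t hz.2 e he hze
  rw [h2.deriv_eq, h2.eq_of_nhds, h4.deriv] at h
  exact h

variable [FiniteDimensional ℝ E]

theorem fderiv_pullback (hΓ : g.IsSmoothGeodesicFamily Γ Il It) {z : ℝ × ℝ} (hz : z ∈ Il ×ˢ It) :
    (∀ v w, DifferentiableAt ℝ (g.pullback (fun z : ℝ × ℝ ↦ Γ z.1 z.2) v w) z) ∧
    fderiv ℝ (g.pullback (fun z : ℝ × ℝ ↦ Γ z.1 z.2) (0, 1) (0, 1)) z (0, 1) = 0 ∧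
    2 * fderiv ℝ (g.pullback (fun z : ℝ × ℝ ↦ Γ z.1 z.2) (1, 0) (0, 1)) z (0, 1) =
      fderiv ℝ (g.pullback (fun z : ℝ × ℝ ↦ Γ z.1 z.2) (0, 1) (0, 1)) z (1, 0) :=
  g.fderiv_pullback (hΓ.contMDiffAt hz) (chart_mem_atlas E _) (mem_chart_source E _) _ _
    (hΓ.geodesic_eq_fderiv hz (chart_mem_atlas E _) (mem_chart_source E _))

/-- Its `t`-derivative vanishes, and `It` is an interval containing `0`. -/
theorem energy_eq_pullback (hΓ : g.IsSmoothGeodesicFamily Γ Il It)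
    (h0 : (0 : ℝ) ∈ It) {l t : ℝ} (hl : l ∈ Il) (ht : t ∈ It) :
    g.pullback (fun z : ℝ × ℝ ↦ Γ z.1 z.2) (0, 1) (0, 1) (l, t) = g.energy Γ l := by
  have hι : ∀ s : ℝ, HasDerivAt (fun s : ℝ ↦ (l, s)) ((0, 1) : ℝ × ℝ) s := fun s ↦
    (hasDerivAt_const s l).prodMk (hasDerivAt_id s)
  have hd : ∀ s ∈ It, HasDerivAt
      (fun s ↦ g.pullback (fun z : ℝ × ℝ ↦ Γ z.1 z.2) (0, 1) (0, 1) (l, s)) 0 s := by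
    intro s hs
    obtain ⟨h1, h2, -⟩ := hΓ.fderiv_pullback (z := (l, s)) ⟨hl, hs⟩
    have h3 := (h1 (0, 1) (0, 1)).hasFDerivAt.comp_hasDerivAt s (hι s)
    rwa [h2] at h3
  have hconst := hΓ.isOpen_time.is_const_of_deriv_eq_zero
    hΓ.ordConnected_time.isPreconnected
    (fun s hs ↦ (hd s hs).differentiableAt.differentiableWithinAt) (fun s hs ↦ (hd s hs).deriv)
    ht h0
  refine hconst.trans ?_
  rw [PseudoRiemannianMetric.energy, hΓ.velocity_time (l := l) (t := 0) ⟨hl, h0⟩]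
  rfl

theorem energy_const (hΓ : g.IsSmoothGeodesicFamily Γ Il It)
    (h0 : (0 : ℝ) ∈ It) {l t : ℝ} (hl : l ∈ Il) (ht : t ∈ It) :
    g.val (Γ l t) (velocity (Γ l) t) (velocity (Γ l) t) = g.energy Γ l := by
  rw [← hΓ.energy_eq_pullback h0 hl ht, hΓ.velocity_time (l := l) (t := t) ⟨hl, ht⟩]
  rfl

/-- Because the energy can be read off at any time, `∂_λ g(∂_tΓ, ∂_tΓ)` equals `h'(l)` for every
`t`; this makes the slope in `pullback_param_time` constant. -/
theorem hasDerivAt_energy (hΓ : g.IsSmoothGeodesicFamily Γ Il It)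
    (h0 : (0 : ℝ) ∈ It) {l t : ℝ} (hl : l ∈ Il) (ht : t ∈ It) :
    HasDerivAt (g.energy Γ)
      (fderiv ℝ (g.pullback (fun z : ℝ × ℝ ↦ Γ z.1 z.2) (0, 1) (0, 1)) (l, t) (1, 0)) l := by
  have hι : HasDerivAt (fun s : ℝ ↦ (s, t)) ((1, 0) : ℝ × ℝ) l :=
    (hasDerivAt_id l).prodMk (hasDerivAt_const l t)
  refine (((hΓ.fderiv_pullback (z := (l, t)) ⟨hl, ht⟩).1 _ _).hasFDerivAt.comp_hasDerivAt l
    hι).congr_of_eventuallyEq ?_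
  filter_upwards [hΓ.isOpen_param.mem_nhds hl] with s hs
  exact (hΓ.energy_eq_pullback h0 hs ht).symm

/-- The function `t ↦ 2 g(∂_l Γ, ∂_t Γ)` is affine with slope `h'(l)`. -/
theorem pullback_param_time (hΓ : g.IsSmoothGeodesicFamily Γ Il It)
    (h0 : (0 : ℝ) ∈ It) {l t : ℝ} (hl : l ∈ Il) (ht : t ∈ It) :
    2 * g.pullback (fun z : ℝ × ℝ ↦ Γ z.1 z.2) (1, 0) (0, 1) (l, t) =
      2 * g.pullback (fun z : ℝ × ℝ ↦ Γ z.1 z.2) (1, 0) (0, 1) (l, 0) +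
        deriv (g.energy Γ) l * t := by
  have hι : ∀ s : ℝ, HasDerivAt (fun s : ℝ ↦ (l, s)) ((0, 1) : ℝ × ℝ) s := fun s ↦
    (hasDerivAt_const s l).prodMk (hasDerivAt_id s)
  have hd : ∀ s ∈ It, HasDerivAt
      (fun s ↦ 2 * g.pullback (fun z : ℝ × ℝ ↦ Γ z.1 z.2) (1, 0) (0, 1) (l, s) -
        deriv (g.energy Γ) l * s) 0 s := by
    intro s hs
    obtain ⟨h1, -, h2⟩ := hΓ.fderiv_pullback (z := (l, s)) ⟨hl, hs⟩
    have h3 := (((h1 (1, 0) (0, 1)).hasFDerivAt.comp_hasDerivAt s (hι s)).const_mul 2).sub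
      ((hasDerivAt_id s).const_mul (deriv (g.energy Γ) l))
    rw [h2, (hΓ.hasDerivAt_energy h0 hl hs).deriv, mul_one, sub_self] at h3
    rw [(hΓ.hasDerivAt_energy h0 hl hs).deriv]
    exact h3
  have hconst := hΓ.isOpen_time.is_const_of_deriv_eq_zero
    hΓ.ordConnected_time.isPreconnected
    (fun s hs ↦ (hd s hs).differentiableAt.differentiableWithinAt) (fun s hs ↦ (hd s hs).deriv)
    ht h0
  simp only [mul_zero, sub_zero] at hconst
  linarith

theorem first_variation (hΓ : g.IsSmoothGeodesicFamily Γ Il It)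
    (h0 : (0 : ℝ) ∈ It) {τ : ℝ → ℝ} {l : ℝ} (hl : l ∈ Il)
    (hτl : τ l ∈ It) (hτ : DifferentiableAt ℝ τ l) :
    2 * g.energy Γ l * deriv τ l + deriv (g.energy Γ) l * τ l =
      2 * g.val (Γ l (τ l)) (velocity (fun s ↦ Γ s (τ s)) l) (velocity (Γ l) (τ l)) -
      2 * g.val (Γ l 0) (velocity (fun s ↦ Γ s 0) l) (velocity (Γ l) 0) := by
  -- The curve `x` is treated as the graph case with travel time identically `0`.
  have hx := hΓ.velocity_graph (τ := fun _ ↦ 0) (differentiableAt_const (x := l) (0 : ℝ)) ⟨hl, h0⟩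
  rw [deriv_const] at hx
  rw [hx, hΓ.velocity_graph hτ ⟨hl, hτl⟩, hΓ.velocity_time ⟨hl, h0⟩,
    hΓ.velocity_time ⟨hl, hτl⟩]
  change _ = 2 * g.pullback (fun z : ℝ × ℝ ↦ Γ z.1 z.2) (1, deriv τ l) (0, 1) (l, τ l) -
    2 * g.pullback (fun z : ℝ × ℝ ↦ Γ z.1 z.2) (1, 0) (0, 1) (l, 0)
  have hsplit : g.pullback (fun z : ℝ × ℝ ↦ Γ z.1 z.2) (1, deriv τ l) (0, 1) (l, τ l) =
      g.pullback (fun z : ℝ × ℝ ↦ Γ z.1 z.2) (1, 0) (0, 1) (l, τ l) + deriv τ l *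
        g.pullback (fun z : ℝ × ℝ ↦ Γ z.1 z.2) (0, 1) (0, 1) (l, τ l) := by
    have h1 : ((1, deriv τ l) : ℝ × ℝ) = (1, 0) + deriv τ l • (0, 1) := by simp
    rw [PseudoRiemannianMetric.pullback, h1]
    erw [map_add, map_smul, map_add, map_smul]
    rfl
  rw [hsplit, hΓ.energy_eq_pullback h0 hl hτl]
  have := hΓ.pullback_param_time h0 hl hτl
  linarith

end PseudoRiemannianMetric.IsSmoothGeodesicFamily

end Family

/-! ### The main theorem -/

theorem proposition6p2
    {E : Type*} [NormedAddCommGroup E] [NormedSpace ℝ E] [FiniteDimensional ℝ E]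
    {M : Type*} [TopologicalSpace M] [T2Space M] [SecondCountableTopology M]
    [ChartedSpace E M] [IsManifold 𝓘(ℝ, E) ∞ M]
    (g : PseudoRiemannianMetric E M) (hg : g.IsRiemannian ∨ g.IsLorentzian)
    (H₁ H₂ : Set M) (hH₁ : IsSmoothHypersurface E H₁) (hH₂ : IsSmoothHypersurface E H₂)
    (Γ : ℝ → ℝ → M) (Il It : Set ℝ) (hΓ : g.IsSmoothGeodesicFamily Γ Il It)
    (τ₀ : ℝ) (hτ₀ : 0 ≤ τ₀) (hIl : (0 : ℝ) ∈ Il) (hIt : Set.Icc 0 τ₀ ⊆ It)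
    (hx₀ : Γ 0 0 ∈ H₁)
    (hy₀ : IsTransversalTo H₂ (velocity (E := E) (Γ 0) τ₀)) :
    ∃ ε > 0, ∃ δ > 0, ∃ τ : ℝ → ℝ,
      Set.Ioo (-ε) ε ⊆ Il ∧ Set.Ioo (τ₀ - δ) (τ₀ + δ) ⊆ It ∧
      -- `τ l` is the travel time of `γ_l`: the unique time near `τ₀` at which `γ_l` meets `H₂`
      τ 0 = τ₀ ∧
      (∀ l ∈ Set.Ioo (-ε) ε, τ l ∈ Set.Ioo (τ₀ - δ) (τ₀ + δ) ∧
        ∀ t ∈ Set.Ioo (τ₀ - δ) (τ₀ + δ), Γ l t ∈ H₂ ↔ t = τ l) ∧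
      -- the intersection is transversal, and the travel time is smooth
      (∀ l ∈ Set.Ioo (-ε) ε, IsTransversalTo H₂ (velocity (E := E) (Γ l) (τ l))) ∧
      ContDiffOn ℝ ∞ τ (Set.Ioo (-ε) ε) ∧
      -- `h(l) = g(γ̇_l(t), γ̇_l(t))` does not depend on `t`
      (∀ l ∈ Set.Ioo (-ε) ε, ∀ t ∈ It,
        g.val (Γ l t) (velocity (Γ l) t) (velocity (Γ l) t) = g.energy Γ l) ∧
      -- the first variation formula, in which `x(l) = γ_l(0)` and `y(l) = γ_l(τ l)`
      (∀ l ∈ Set.Ioo (-ε) ε,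
        DifferentiableAt ℝ (g.energy Γ) l ∧
        MDifferentiableAt 𝓘(ℝ, ℝ) 𝓘(ℝ, E) (fun s ↦ Γ s 0) l ∧
        MDifferentiableAt 𝓘(ℝ, ℝ) 𝓘(ℝ, E) (fun s ↦ Γ s (τ s)) l ∧
        2 * g.energy Γ l * deriv τ l + deriv (g.energy Γ) l * τ l =
          2 * g.val (Γ l (τ l)) (velocity (fun s ↦ Γ s (τ s)) l) (velocity (Γ l) (τ l)) -
          2 * g.val (Γ l 0) (velocity (fun s ↦ Γ s 0) l) (velocity (Γ l) 0)) ∧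
      -- recovery of the travel time of a lightlike `γ_0`
      (g.energy Γ 0 = 0 → deriv (g.energy Γ) 0 ≠ 0 →
        τ₀ = 2 / deriv (g.energy Γ) 0 *
          (g.val (Γ 0 (τ 0)) (velocity (fun s ↦ Γ s (τ s)) 0) (velocity (Γ 0) (τ 0)) -
            g.val (Γ 0 0) (velocity (fun s ↦ Γ s 0) 0) (velocity (Γ 0) 0))) := by
  have h0 : (0 : ℝ) ∈ It := hIt ⟨le_rfl, hτ₀⟩
  have hτ₀t : τ₀ ∈ It := hIt ⟨hτ₀, le_rfl⟩
  obtain ⟨hmem, U, φ, hU, hφ, hne⟩ := hy₀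
  set F : ℝ × ℝ → M := fun z ↦ Γ z.1 z.2 with hF
  set W : Set (ℝ × ℝ) := Il ×ˢ It ∩ F ⁻¹' U with hWdef
  have hW : IsOpen W := hΓ.contMDiffOn.continuousOn.isOpen_inter_preimage
    (hΓ.isOpen_param.prod hΓ.isOpen_time) hφ.isOpen
  have hsm : ContDiffOn ℝ ∞ (φ ∘ F) W :=
    (hφ.contMDiffOn.comp (hΓ.contMDiffOn.mono Set.inter_subset_left)
      fun z hz ↦ hz.2).contDiffOn
  -- This translates transversality to `H₂` into the derivative condition of the implicit function
  -- theorem, and back again at each `τ l`.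
  have hder : ∀ l t, (l, t) ∈ W → fderiv ℝ (φ ∘ F) (l, t) (0, 1) =
      mfderiv 𝓘(ℝ, E) 𝓘(ℝ, ℝ) φ (Γ l t) (velocity (E := E) (Γ l) t) := by
    intro l t hz
    rw [hΓ.velocity_time hz.1, ← mfderiv_eq_fderiv, mfderiv_comp (l, t)
      ((hφ.contMDiffOn.contMDiffAt (hφ.isOpen.mem_nhds hz.2)).mdifferentiableAt (by simp))
      (hΓ.mdifferentiableAt hz.1)]
    rfl
  have hz₀ : ((0 : ℝ), τ₀) ∈ W := ⟨⟨hIl, hτ₀t⟩, hU⟩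
  obtain ⟨ε, hε, δ, hδ, τ, hbox, hτ0, hτ, hτs⟩ := exists_contDiffOn_graph hW hsm hz₀
    ((hφ.mem_iff _ hU).1 hmem) ((hder _ _ hz₀).trans_ne hne)
  have hε0 : (0 : ℝ) ∈ Set.Ioo (-ε) ε := ⟨by linarith, hε⟩
  have hτ₀δ : τ₀ ∈ Set.Ioo (τ₀ - δ) (τ₀ + δ) := ⟨by linarith, by linarith⟩
  have hIlε : Set.Ioo (-ε) ε ⊆ Il := fun l hl ↦ (hbox (Set.mk_mem_prod hl hτ₀δ)).1.1
  have hItδ : Set.Ioo (τ₀ - δ) (τ₀ + δ) ⊆ It := fun t ht ↦ (hbox (Set.mk_mem_prod hε0 ht)).1.2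
  have hτd : ∀ l ∈ Set.Ioo (-ε) ε, DifferentiableAt ℝ τ l := fun l hl ↦
    (hτs.contDiffAt (isOpen_Ioo.mem_nhds hl)).differentiableAt (by simp)
  have hmeet : ∀ l ∈ Set.Ioo (-ε) ε, ∀ t ∈ Set.Ioo (τ₀ - δ) (τ₀ + δ), Γ l t ∈ H₂ ↔ t = τ l :=
    fun l hl t ht ↦ (hφ.mem_iff _ (hbox (Set.mk_mem_prod hl ht)).2).trans ((hτ l hl).2.2 t ht)
  have hfv : ∀ l ∈ Set.Ioo (-ε) ε, _ := fun l hl ↦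
    hΓ.first_variation h0 (hIlε hl) (hItδ (hτ l hl).1) (hτd l hl)
  refine ⟨ε, hε, δ, hδ, τ, hIlε, hItδ, hτ0, fun l hl ↦ ⟨(hτ l hl).1, hmeet l hl⟩,
    fun l hl ↦ ?_, hτs, fun l hl t ht ↦ hΓ.energy_const h0 (hIlε hl) ht,
    fun l hl ↦ ⟨(hΓ.hasDerivAt_energy h0 (hIlε hl) h0).differentiableAt,
      hΓ.mdifferentiableAt_graph (τ := fun _ ↦ 0) (differentiableAt_const _) ⟨hIlε hl, h0⟩,
      hΓ.mdifferentiableAt_graph (hτd l hl) ⟨hIlε hl, hItδ (hτ l hl).1⟩, hfv l hl⟩,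
    fun he he' ↦ ?_⟩
  · have hz := hbox (Set.mk_mem_prod hl (hτ l hl).1)
    exact ⟨(hmeet l hl _ (hτ l hl).1).2 rfl, U, φ, hz.2, hφ,
      (hder _ _ hz).symm.trans_ne (hτ l hl).2.1⟩
  -- At a null geodesic the term with the unknown `τ'(0)` drops out, leaving a linear equation for
  -- `τ₀`.
  · have h := hfv 0 hε0
    rw [he, mul_zero, zero_mul, zero_add] at h
    rw [div_mul_eq_mul_div, eq_div_iff he', mul_sub, ← h, hτ0, mul_comm]
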